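/- For an integer $m\ge 1$ let $\mathbb{T}_m=(\mathbb{Z}/m\mathbb{Z})^2$, with the point $(0,0)$ designated as the sink. A sandpile is a function $\sigma:\mathbb{T}_m\setminus\{(0,0)\}\to\mathbb{Z}_{\ge 0}$. A non-sink vertex $x$ with $\sigma(x)\ge 4$ may topple (legally): it loses four grains and passes one grain along each of the edges to $x\pm(1,0)$ and $x\pm(0,1)$; grains that fall on the sink are lost. The sandpile is stable if $\sigma\le 3$ everywhere, and $\mathscr{S}_m$ denotes the set of stable sandpiles. Every sandpile reaches, by finitely many legal topplings, a unique stable sandpile, called its stabilization. The sandpile Markov chain on $\mathscr{S}_m$ has transition operator $P_m$: from $\sigma$, choose $x\in\mathbb{T}_m$ uniformly at random; if $x\ne(0,0)$, move to the stabilization of $\sigma+\mathbf{e}_x$, where $\mathbf{e}_x$ is a single grain at $x$; if $x=(0,0)$, stay at $\sigma$. Let $P_m^n\delta_\sigma$ be the law of the chain after $n$ steps started from $\sigma$, and let $\mathscr{R}_m\subset\mathscr{S}_m$ be the set of recurrent states, that is, of the stable states that the chain can reach from the maximal state $\sigma\equiv 3$. **Proposition 4.1.** There are a constant $C>0$ and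 a function $\delta:\mathbb{N}\to\mathbb{R}$ with $\delta(m)\to 0$ as $m\to\infty$ such that for every integer $m\ge 1$, every $\sigma\in\mathscr{S}_m$ and every integer $n\ge 0$ with $n>Cm^2\sqrt{\log m}$, $$(P_m^n\delta_\sigma)(\mathscr{R}_m)\ \ge\ 1-\delta(m).$$ -/

import Mathlib

open Filter Topology

namespace TorusSandpile

/-- The discrete torus `(ℤ/mℤ)²`; the point `0 = (0,0)` is the sink. -/
abbrev Torus (m : ℕ) : Type := ZMod m × ZMod m

/-- The non-sink vertices. -/
abbrev Site (m : ℕ) : Type := {x : Torus m // x ≠ 0}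

/-- Sand allocations on the non-sink vertices. -/
abbrev Sandpile (m : ℕ) : Type := Site m → ℕ

/-- How many of the four neighbours `x ± (1,0)`, `x ± (0,1)` of `x` are equal to `y`
(for `m = 2` there are double edges). -/
def edges {m : ℕ} (x y : Torus m) : ℕ :=
  (if y = x + (1, 0) then 1 else 0) + (if y = x - (1, 0) then 1 else 0) +
    (if y = x + (0, 1) then 1 else 0) + (if y = x - (0, 1) then 1 else 0)

/-- The sandpile after toppling `x`: the vertex `x` loses four grains and one grain is passed along
each of its four edges; grains passed to the sink are lost. It is only used when `4 ≤ σ x`, so that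
the subtraction does not truncate. -/
def topple {m : ℕ} (σ : Sandpile m) (x : Site m) : Sandpile m :=
  fun y => (σ y - if y = x then 4 else 0) + edges x.1 y.1

/-- `τ` arises from `σ` by one legal toppling. -/
def LegalTopple {m : ℕ} (σ τ : Sandpile m) : Prop :=
  ∃ x : Site m, 4 ≤ σ x ∧ τ = topple σ x

/-- No vertex can topple. -/
def IsStable {m : ℕ} (σ : Sandpile m) : Prop := ∀ x, σ x ≤ 3

/-- `τ` is a stable sandpile that is reached from `σ` by finitely many legal topplings. -/
def StabilizesTo {m : ℕ} (σ τ : Sandpile m) : Prop :=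
  Relation.ReflTransGen LegalTopple σ τ ∧ IsStable τ

/-! Every sandpile stabilizes: a weight that decreases with each legal toppling. -/

/-- An auxiliary weight on the torus, zero at the sink and strictly superharmonic elsewhere. -/
def weight {m : ℕ} (x : Torus m) : ℕ := 4 ^ (2 * m) - 4 ^ (2 * m - (x.1.val + x.2.val))

theorem weight_zero {m : ℕ} : weight (0 : Torus m) = 0 := by simp [weight]

theorem weight_add {m : ℕ} (x : Torus m) :
    weight x + 4 ^ (2 * m - (x.1.val + x.2.val)) = 4 ^ (2 * m) :=
  Nat.sub_add_cancel (Nat.pow_le_pow_right (by norm_num) (Nat.sub_le _ _))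

theorem val_sub_one {m : ℕ} [NeZero m] (a : ZMod m) (ha : a ≠ 0) : (a - 1).val + 1 = a.val := by
  have hpos : 0 < a.val := Nat.pos_of_ne_zero (by simpa using ha)
  have hlt := a.val_lt
  have h1 : a - 1 = ((a.val - 1 : ℕ) : ZMod m) := by
    rw [Nat.cast_sub hpos]; simp
  rw [h1, ZMod.val_cast_of_lt (by omega)]
  omega

theorem weight_superharmonic {m : ℕ} [NeZero m] (x : Torus m) (hx : x ≠ 0) :
    weight (x + (1, 0)) + weight (x - (1, 0)) + weight (x + (0, 1)) + weight (x - (0, 1))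
      < 4 * weight x := by
  have h0 := weight_add x
  have h1 := weight_add (x + (1, 0))
  have h2 := weight_add (x - (1, 0))
  have h3 := weight_add (x + (0, 1))
  have h4 := weight_add (x - (0, 1))
  have p1 : 0 < 4 ^ (2 * m - ((x + (1, 0)).1.val + (x + (1, 0)).2.val)) := by positivity
  have p2 : 0 < 4 ^ (2 * m - ((x - (1, 0)).1.val + (x - (1, 0)).2.val)) := by positivity
  have p3 : 0 < 4 ^ (2 * m - ((x + (0, 1)).1.val + (x + (0, 1)).2.val)) := by positivity
  have p4 : 0 < 4 ^ (2 * m - ((x - (0, 1)).1.val + (x - (0, 1)).2.val)) := by positivity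
  have b1 := x.1.val_lt
  have b2 := x.2.val_lt
  by_cases hx1 : x.1 = 0
  · have hx2 : x.2 ≠ 0 := fun h => hx (Prod.ext hx1 h)
    have e := val_sub_one x.2 hx2
    have key : 4 ^ (2 * m - ((x - (0, 1)).1.val + (x - (0, 1)).2.val))
        = 4 * 4 ^ (2 * m - (x.1.val + x.2.val)) := by
      rw [← pow_succ']
      congr 1
      simp only [Prod.fst_sub, Prod.snd_sub, sub_zero]
      omega
    omega
  · have e := val_sub_one x.1 hx1
    have key : 4 ^ (2 * m - ((x - (1, 0)).1.val + (x - (1, 0)).2.val))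
        = 4 * 4 ^ (2 * m - (x.1.val + x.2.val)) := by
      rw [← pow_succ']
      congr 1
      simp only [Prod.fst_sub, Prod.snd_sub, sub_zero]
      omega
    omega

theorem sum_ite_weight_le {m : ℕ} [NeZero m] (z : Torus m) :
    ∑ y : Site m, (if y.1 = z then 1 else 0) * weight y.1 ≤ weight z := by
  by_cases hz : z = 0
  · rw [Finset.sum_eq_zero]
    · exact Nat.zero_le _
    · intro y _
      rw [if_neg (fun h => y.2 (h.trans hz)), zero_mul]
  · rw [Finset.sum_eq_single (⟨z, hz⟩ : Site m)]
    · simp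
    · intro y _ hy
      rw [if_neg (fun h => hy (Subtype.ext h)), zero_mul]
    · simp

theorem sum_edges_weight_lt {m : ℕ} [NeZero m] (x : Site m) :
    ∑ y : Site m, edges x.1 y.1 * weight y.1 < 4 * weight x.1 := by
  refine lt_of_le_of_lt ?_ (weight_superharmonic x.1 x.2)
  simp only [edges, add_mul, Finset.sum_add_distrib]
  gcongr <;> exact sum_ite_weight_le _

theorem energy_topple_lt {m : ℕ} [NeZero m] (σ : Sandpile m) (x : Site m) (hx : 4 ≤ σ x) :
    ∑ y, topple σ x y * weight y.1 < ∑ y, σ y * weight y.1 := by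
  have h1 := sum_edges_weight_lt x
  have h2 : ∑ y, topple σ x y * weight y.1 + 4 * weight x.1
      = ∑ y, σ y * weight y.1 + ∑ y : Site m, edges x.1 y.1 * weight y.1 := by
    have : 4 * weight x.1 = ∑ y : Site m, (if y = x then 4 else 0) * weight y.1 := by
      simp [ite_mul]
    rw [this, ← Finset.sum_add_distrib, ← Finset.sum_add_distrib]
    refine Finset.sum_congr rfl fun y _ => ?_
    rw [← add_mul, ← add_mul]
    congr 1
    unfold topple
    split_ifs with h
    · subst h; omega
    · omega
  omega

theorem exists_stabilizesTo {m : ℕ} [NeZero m] (σ : Sandpile m) : ∃ τ, StabilizesTo σ τ := by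
  induction h : ∑ y, σ y * weight y.1 using Nat.strong_induction_on generalizing σ with
  | _ N ih =>
    by_cases hs : IsStable σ
    · exact ⟨σ, .refl, hs⟩
    · simp only [IsStable, not_forall, not_le] at hs
      obtain ⟨x, hx⟩ := hs
      obtain ⟨τ, h1, h2⟩ := ih _ (h ▸ energy_topple_lt σ x hx) (topple σ x) rfl
      exact ⟨τ, .head ⟨x, hx, rfl⟩ h1, h2⟩

/-- The abelian property: the stable sandpile that is reached does not depend on the order of the
topplings. -/
theorem StabilizesTo.unique {m : ℕ} {σ τ τ' : Sandpile m} (h : StabilizesTo σ τ)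
    (h' : StabilizesTo σ τ') : τ = τ' := by
  have stuck : ∀ {a b : Sandpile m}, IsStable a → Relation.ReflTransGen LegalTopple a b → a = b := by
    intro a b ha hab
    rcases hab.cases_head with h | ⟨c, ⟨x, hx, _⟩, _⟩
    · exact h
    · exact absurd (ha x) (by omega)
  obtain ⟨ρ, h1, h2⟩ := Relation.church_rosser (r := LegalTopple (m := m)) (by
    rintro a b c ⟨x, hx, rfl⟩ ⟨y, hy, rfl⟩
    by_cases hxy : x = y
    · subst hxy
      exact ⟨_, .refl, .refl⟩
    · have hyx : ¬ y = x := fun e => hxy e.symm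
      refine ⟨topple (topple a x) y, .single ⟨y, ?_, rfl⟩, .single ⟨x, ?_, ?_⟩⟩
      · simp only [topple, if_neg hyx]; omega
      · simp only [topple, if_neg hxy]; omega
      · funext z
        simp only [topple]
        by_cases hzx : z = x
        · subst hzx; simp only [if_neg hxy, if_true]; omega
        · by_cases hzy : z = y
          · subst hzy; simp only [if_neg hzx, if_true]; omega
          · simp only [if_neg hzx, if_neg hzy]; omega) h.1 h'.1
  rw [stuck h.2 h1, stuck h'.2 h2]

/-- The set of stable states of the model. -/
abbrev StableState (m : ℕ) : Type := {σ : Sandpile m // IsStable σ}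

/-- The stabilization of a sandpile: the stable sandpile that is reached from it by legal
topplings (it exists by `exists_stabilizesTo` and is unique by `StabilizesTo.unique`). -/
noncomputable def stabilize {m : ℕ} [NeZero m] (σ : Sandpile m) : StableState m :=
  ⟨(exists_stabilizesTo σ).choose, (exists_stabilizesTo σ).choose_spec.2⟩

/-- Drop one grain on the vertex `x` and stabilize; nothing happens if `x` is the sink. -/
noncomputable def dropGrain {m : ℕ} [NeZero m] (σ : StableState m) (x : Torus m) :
    StableState m :=
  if hx : x ≠ 0 then stabilize (σ.1 + Pi.single (⟨x, hx⟩ : Site m) 1) else σ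

/-- The transition kernel of the sandpile Markov chain: one grain is dropped on a uniformly random
vertex of the torus. -/
noncomputable def step {m : ℕ} [NeZero m] (σ : StableState m) : PMF (StableState m) :=
  (PMF.uniformOfFintype (Torus m)).map (dropGrain σ)

/-- The law of the sandpile Markov chain after `n` steps from the state `σ`. -/
noncomputable def law {m : ℕ} [NeZero m] (σ : StableState m) : ℕ → PMF (StableState m)
  | 0 => PMF.pure σ
  | n + 1 => (law σ n).bind step

/-- The maximal stable state, with three grains on every non-sink vertex. -/
def maxState (m : ℕ) : StableState m := ⟨fun _ => 3, fun _ => le_rfl⟩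

/-- The recurrent states: those which the chain may reach from the maximal state. -/
def recurrentStates (m : ℕ) [NeZero m] : Set (StableState m) :=
  {τ | ∃ n, τ ∈ (law (maxState m) n).support}

end TorusSandpile

/-!
The proof rests on the odometer `v` of a stabilization `σ → η`, where `v x` is the number of times
that `x` topples.

*Recurrence.* If every site topples at least once, then `η` has no forbidden subconfiguration
(`exists_odometer`): in any nonempty set `F` of sites, the one that stops toppling first has at the
end at least as many grains as neighbours in `F`. By Dhar's burning algorithm such an `η` is
restored when the sink is fired, any number of times; since enough firings of the sink put three
grains on every site, `η` is recurrent (`mem_recurrentStates_of_no_forbidden`).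

*Every site topples.* For a site `x` let `h y` be the probability that simple random walk from `y`
hits `x` before the sink. As `h` is harmonic off `x` and the sink, and vanishes at the sink, a
toppling at a site other than `x` conserves `∑ y, h y * σ y`. If `x` does not topple at all, then
`∑ y, h y * σ y = ∑ y, h y * η y ≤ 3 * ∑ y, h y`. The reflection `y ↦ x - y` exchanges `x` with the
sink, which gives `∑ y, h y = m ^ 2 / 2` (`exists_hitting_probability`), without any estimate of a
Green's function.

*Probability.* By the abelian property the topplings may be postponed until all the grains have
been dropped (`law_eq_map_rawLaw`). Each of the `n` grains adds to `∑ y, h y * σ y` an independent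
amount in `[0, 1]` of mean one half, so by the exponential Markov inequality this sum is at most
`3 * m ^ 2 / 2` with probability at most `exp (3 * m ^ 2 / 2 - n / 4)`. With `n > 8 * m ^ 2` this
is small enough for a union bound over the sites.
-/

namespace TorusSandpile

variable {m : ℕ}

/-! ### Legal topplings -/

theorem edges_comm (x y : Torus m) : edges x y = edges y x := by
  have h1 : y = x + (1, 0) ↔ x = y - (1, 0) := by rw [eq_sub_iff_add_eq, eq_comm]
  have h2 : y = x - (1, 0) ↔ x = y + (1, 0) := by rw [eq_sub_iff_add_eq, eq_comm]
  have h3 : y = x + (0, 1) ↔ x = y - (0, 1) := by rw [eq_sub_iff_add_eq, eq_comm]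
  have h4 : y = x - (0, 1) ↔ x = y + (0, 1) := by rw [eq_sub_iff_add_eq, eq_comm]
  simp only [edges, h1, h2, h3, h4]
  ring

theorem edges_self (hm : 2 ≤ m) (x : Torus m) : edges x x = 0 := by
  have : Fact (1 < m) := ⟨hm⟩
  have h : ∀ a : ZMod m, a ≠ a - 1 := fun a e => by simpa using sub_eq_self.1 e.symm
  simp [edges, Prod.ext_iff, h]

theorem topple_add_four {σ : Sandpile m} {x : Site m} (hx : 4 ≤ σ x) (y : Site m) :
    topple σ x y + (if y = x then 4 else 0) = σ y + edges x.1 y.1 := by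
  unfold topple
  split_ifs with h
  · subst h; omega
  · omega

theorem LegalTopple.add_right {σ τ : Sandpile m} (h : LegalTopple σ τ) (g : Sandpile m) :
    LegalTopple (σ + g) (τ + g) := by
  obtain ⟨x, hx, rfl⟩ := h
  have hx' : 4 ≤ (σ + g) x := le_add_right hx
  refine ⟨x, hx', funext fun y => ?_⟩
  have h1 := topple_add_four hx y
  have h2 := topple_add_four hx' y
  simp only [Pi.add_apply] at h2 ⊢
  omega

theorem legalPath_add_right {σ τ : Sandpile m}
    (h : Relation.ReflTransGen LegalTopple σ τ) (g : Sandpile m) :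
    Relation.ReflTransGen LegalTopple (σ + g) (τ + g) :=
  h.lift (· + g) fun _ _ h => h.add_right g

theorem stabilizesTo_stabilize [NeZero m] (σ : Sandpile m) : StabilizesTo σ (stabilize σ).1 :=
  (exists_stabilizesTo σ).choose_spec

theorem StabilizesTo.stabilize_eq [NeZero m] {σ : Sandpile m} {τ : StableState m}
    (h : StabilizesTo σ τ.1) : stabilize σ = τ :=
  Subtype.ext ((stabilizesTo_stabilize σ).unique h)

theorem stabilize_eq_of_legalPath [NeZero m] {σ τ : Sandpile m}
    (h : Relation.ReflTransGen LegalTopple σ τ) : stabilize σ = stabilize τ :=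
  StabilizesTo.stabilize_eq ⟨h.trans (stabilizesTo_stabilize τ).1, (stabilize τ).2⟩

theorem stabilize_stabilize_add [NeZero m] (σ g : Sandpile m) :
    stabilize ((stabilize σ).1 + g) = stabilize (σ + g) :=
  (stabilize_eq_of_legalPath (legalPath_add_right (stabilizesTo_stabilize σ).1 g)).symm

/-- A legal sequence of topplings has an odometer `v` (the number of topplings at each site), and
it leaves no forbidden subconfiguration inside the set of toppled sites: given a set `F` of toppled
sites, the one that stops toppling first has since received a grain from each of the others. -/
theorem exists_odometer [NeZero m] (hm : 2 ≤ m) {σ τ : Sandpile m}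
    (h : Relation.ReflTransGen LegalTopple σ τ) :
    ∃ v : Site m → ℕ, (∀ y, τ y + 4 * v y = σ y + ∑ x, v x * edges x.1 y.1) ∧
      ∀ F : Finset (Site m), F.Nonempty → (∀ x ∈ F, v x ≠ 0) →
        ∃ x ∈ F, ∑ y ∈ F, edges y.1 x.1 ≤ τ x := by
  induction h with
  | refl => exact ⟨0, by simp, fun F ⟨x, hx⟩ hF => absurd rfl (hF x hx)⟩
  | @tail ρ τ _ hst ih =>
    obtain ⟨z, hz, rfl⟩ := hst
    obtain ⟨v, hv, hF⟩ := ih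
    refine ⟨v + Pi.single z 1, fun y => ?_, fun F hne hpos => ?_⟩
    · have h1 := topple_add_four hz y
      have h2 := hv y
      have h3 : ∑ x, (v + Pi.single z 1 : Site m → ℕ) x * edges x.1 y.1
          = ∑ x, v x * edges x.1 y.1 + edges z.1 y.1 := by
        simp [add_mul, Finset.sum_add_distrib, Pi.single_apply]
      rw [h3]
      simp only [Pi.add_apply, Pi.single_apply]
      split_ifs at h1 ⊢ <;> omega
    · have hpos' : ∀ x ∈ F.erase z, v x ≠ 0 := fun x hx => by
        have := hpos x (Finset.mem_of_mem_erase hx)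
        simpa [Finset.ne_of_mem_erase hx] using this
      rcases (F.erase z).eq_empty_or_nonempty with he | hne'
      · obtain ⟨x, hx⟩ := hne
        refine ⟨x, hx, ?_⟩
        rw [Finset.sum_eq_zero]
        · exact Nat.zero_le _
        · intro y hy
          have hxz : x = z := by
            by_contra hc
            exact Finset.notMem_empty x (he ▸ Finset.mem_erase.2 ⟨hc, hx⟩)
          have hyz : y = z := by
            by_contra hc
            exact Finset.notMem_empty y (he ▸ Finset.mem_erase.2 ⟨hc, hy⟩)
          rw [hxz, hyz, edges_self hm]
      · obtain ⟨x, hx, hle⟩ := hF _ hne' hpos'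
        refine ⟨x, Finset.mem_of_mem_erase hx, ?_⟩
        have h1 := topple_add_four hz x
        rw [if_neg (Finset.ne_of_mem_erase hx)] at h1
        by_cases hzF : z ∈ F
        · rw [← Finset.sum_erase_add _ _ hzF]
          omega
        · rw [Finset.erase_eq_of_notMem hzF] at hle
          omega

/-- If each site `x` carries at least `4 * u x` grains, then it can legally topple `u x` times,
whatever the order of the topplings. -/
theorem exists_legalPath_of_le [NeZero m] (u c : Sandpile m) (hu : ∀ x, 4 * u x ≤ c x) :
    ∃ c', Relation.ReflTransGen LegalTopple c c' ∧
      ∀ y, c' y + 4 * u y = c y + ∑ x, u x * edges x.1 y.1 := by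
  induction h : ∑ x, u x generalizing u c with
  | zero =>
    have h0 : u = 0 := by
      funext x
      simpa using (Finset.sum_eq_zero_iff.1 h) x (Finset.mem_univ x)
    subst h0
    exact ⟨c, .refl, by simp⟩
  | succ k ih =>
    obtain ⟨z, -, hz⟩ : ∃ z ∈ Finset.univ, u z ≠ 0 :=
      Finset.exists_ne_zero_of_sum_ne_zero (by omega)
    obtain ⟨w, rfl⟩ : ∃ w : Sandpile m, u = w + Pi.single z 1 := by
      refine ⟨u - Pi.single z 1, funext fun y => ?_⟩
      simp only [Pi.add_apply, Pi.sub_apply, Pi.single_apply]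
      split_ifs with hy
      · subst hy; omega
      · omega
    have hcz : 4 ≤ c z := by
      have := hu z
      simp only [Pi.add_apply, Pi.single_eq_same] at this
      omega
    have hsum : ∑ x, w x = k := by
      simpa [Finset.sum_add_distrib, Pi.single_apply] using h
    obtain ⟨c', hpath, hc'⟩ := ih w (topple c z) (fun y => by
      have h1 := topple_add_four hcz y
      have h2 := hu y
      simp only [Pi.add_apply, Pi.single_apply] at h2
      split_ifs at h1 h2 <;> omega) hsum
    refine ⟨c', .head ⟨z, hcz, rfl⟩ hpath, fun y => ?_⟩
    have h1 := topple_add_four hcz y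
    have h2 := hc' y
    have h3 : ∑ x, (w + Pi.single z 1 : Sandpile m) x * edges x.1 y.1
        = ∑ x, w x * edges x.1 y.1 + edges z.1 y.1 := by
      simp [add_mul, Finset.sum_add_distrib, Pi.single_apply]
    rw [h3]
    simp only [Pi.add_apply, Pi.single_apply]
    split_ifs at h1 ⊢ <;> omega

/-! ### Recurrence -/

/-- The grains that the non-sink vertices receive when the sink topples once. -/
def sinkFiring (m : ℕ) : Sandpile m := fun y => edges 0 y.1

theorem sum_site_eq [NeZero m] {M : Type*} [AddCommMonoid M] (f : Torus m → M) (hf : f 0 = 0) :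
    ∑ y : Site m, f y.1 = ∑ y, f y := by
  rw [Fintype.sum_eq_add_sum_subtype_ne f 0, hf, zero_add]

theorem sum_edges_mul [NeZero m] (f : Torus m → ℝ) (x : Torus m) :
    ∑ y, (edges x y : ℝ) * f y
      = f (x + (1, 0)) + f (x - (1, 0)) + f (x + (0, 1)) + f (x - (0, 1)) := by
  simp [edges, add_mul, Finset.sum_add_distrib]

theorem sum_edges_site [NeZero m] (x : Site m) :
    edges 0 x.1 + ∑ y : Site m, edges y.1 x.1 = 4 := by
  rw [← Fintype.sum_eq_add_sum_subtype_ne (fun y => edges y x.1) 0]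
  simp only [edges_comm _ x.1]
  simp [edges, Finset.sum_add_distrib]

/-- Every site can be filled by firing the sink often enough. The filled region grows with the
distance `x.1.val + x.2.val` to the sink along monotone paths. -/
theorem exists_fill_of_dist [NeZero m] (hm : 2 ≤ m) (d M : ℕ) :
    ∃ (k : ℕ) (c : Sandpile m), Relation.ReflTransGen LegalTopple (k • sinkFiring m) c ∧
      ∀ x : Site m, x.1.1.val + x.1.2.val ≤ d + 1 → M ≤ c x := by
  have : Fact (1 < m) := ⟨hm⟩
  have back : ∀ x : Torus m, x ≠ 0 → ∃ y : Torus m,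
      y.1.val + y.2.val + 1 = x.1.val + x.2.val ∧ 1 ≤ edges y x := by
    intro x hx
    by_cases h1 : x.1 = 0
    · have h2 : x.2 ≠ 0 := fun h => hx (Prod.ext h1 h)
      have e := val_sub_one x.2 h2
      refine ⟨x - (0, 1), by simp only [Prod.fst_sub, Prod.snd_sub, sub_zero]; omega, ?_⟩
      simp only [edges, sub_add_cancel, if_true]
      omega
    · have e := val_sub_one x.1 h1
      refine ⟨x - (1, 0), by simp only [Prod.fst_sub, Prod.snd_sub, sub_zero]; omega, ?_⟩
      simp only [edges, sub_add_cancel, if_true]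
      omega
  induction d generalizing M with
  | zero =>
    refine ⟨M, _, .refl, fun x hx => ?_⟩
    obtain ⟨y, hy, he⟩ := back x.1 x.2
    have hy0 : y = 0 := Prod.ext ((ZMod.val_eq_zero _).1 (by omega)) ((ZMod.val_eq_zero _).1 (by omega))
    subst hy0
    simpa [sinkFiring] using Nat.mul_le_mul_left M he
  | succ d ih =>
    obtain ⟨k, c, hc, hM⟩ := ih (5 * M)
    set u : Sandpile m := fun x => if x.1.1.val + x.1.2.val ≤ d + 1 then M else 0 with hu
    obtain ⟨c', hp, hc'⟩ := exists_legalPath_of_le u c (fun x => by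
      simp only [hu]
      split_ifs with h
      · have := hM x h; omega
      · omega)
    refine ⟨k, c', hc.trans hp, fun x hx => ?_⟩
    have h1 := hc' x
    by_cases hxd : x.1.1.val + x.1.2.val ≤ d + 1
    · have h2 := hM x hxd
      have h3 : u x = M := if_pos hxd
      omega
    · have h3 : u x = 0 := if_neg hxd
      obtain ⟨y, hy, he⟩ := back x.1 x.2
      have hy0 : y ≠ 0 := by
        rintro rfl
        simp only [Prod.fst_zero, Prod.snd_zero, ZMod.val_zero] at hy
        omega
      have h4 : u ⟨y, hy0⟩ = M := if_pos (by simp only; omega)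
      have h5 : u ⟨y, hy0⟩ * edges y x.1 ≤ ∑ z : Site m, u z * edges z.1 x.1 :=
        Finset.single_le_sum (f := fun z : Site m => u z * edges z.1 x.1)
          (fun _ _ => Nat.zero_le _) (Finset.mem_univ (⟨y, hy0⟩ : Site m))
      have h6 : M * 1 ≤ M * edges y x.1 := Nat.mul_le_mul_left M he
      rw [h4] at h5
      omega

theorem exists_fill [NeZero m] (hm : 2 ≤ m) (M : ℕ) :
    ∃ (k : ℕ) (c : Sandpile m), Relation.ReflTransGen LegalTopple (k • sinkFiring m) c ∧ ∀ x, M ≤ c x := by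
  obtain ⟨k, c, hc, h⟩ := exists_fill_of_dist hm (2 * m) M
  refine ⟨k, c, hc, fun x => h x ?_⟩
  have h1 := x.1.1.val_lt
  have h2 := x.1.2.val_lt
  omega

/-- Dhar's burning algorithm: if `η` has no forbidden subconfiguration, then after the sink fires
every other vertex can topple once, which restores `η`. -/
theorem legalPath_add_sinkFiring [NeZero m] {η : Sandpile m}
    (hη : ∀ F : Finset (Site m), F.Nonempty → ∃ x ∈ F, ∑ y ∈ F, edges y.1 x.1 ≤ η x) :
    Relation.ReflTransGen LegalTopple (η + sinkFiring m) η := by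
  -- `F` is the set of sites that have yet to topple.
  suffices key : ∀ (F : Finset (Site m)) (c : Sandpile m),
      (∀ y, (c y + if y ∈ F then 0 else 4) + ∑ x ∈ F, edges x.1 y.1 = η y + 4) →
        Relation.ReflTransGen LegalTopple c η by
    refine key Finset.univ _ fun y => ?_
    have := sum_edges_site y
    simp only [Pi.add_apply, sinkFiring, Finset.mem_univ, if_true]
    omega
  intro F
  induction F using Finset.strongInduction with
  | H F ih =>
    intro c hc
    rcases F.eq_empty_or_nonempty with rfl | hne
    · have : c = η := funext fun y => by simpa using hc y
      exact this ▸ .refl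
    · obtain ⟨x, hx, hle⟩ := hη F hne
      have hcx : 4 ≤ c x := by
        have := hc x
        rw [if_pos hx] at this
        omega
      refine .head ⟨x, hcx, rfl⟩ (ih _ (Finset.erase_ssubset hx) _ fun y => ?_)
      have h1 := topple_add_four hcx y
      have h2 := hc y
      rw [← Finset.add_sum_erase _ _ hx] at h2
      by_cases hyx : y = x
      · subst hyx
        simp only [hx, Finset.notMem_erase, if_true, if_false] at h1 h2 ⊢
        omega
      · simp only [Finset.mem_erase, hyx, ne_eq, not_false_eq_true, true_and, if_false]
          at h1 h2 ⊢
        omega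

/-- The sandpile `σ` with one more grain at `x`; a grain dropped on the sink is lost. -/
def addGrain (σ : Sandpile m) (x : Torus m) : Sandpile m :=
  if hx : x ≠ 0 then σ + Pi.single (⟨x, hx⟩ : Site m) 1 else σ

theorem dropGrain_stabilize [NeZero m] (σ : Sandpile m) (x : Torus m) :
    dropGrain (stabilize σ) x = stabilize (addGrain σ x) := by
  unfold dropGrain addGrain
  split_ifs
  · rw [stabilize_stabilize_add]
  · rfl

theorem stabilize_stable [NeZero m] (σ : StableState m) : stabilize σ.1 = σ :=
  StabilizesTo.stabilize_eq ⟨.refl, σ.2⟩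

theorem stabilize_addGrain_mem_recurrentStates [NeZero m] {σ : Sandpile m}
    (h : stabilize σ ∈ recurrentStates m) (x : Torus m) :
    stabilize (addGrain σ x) ∈ recurrentStates m := by
  obtain ⟨n, hn⟩ := h
  refine ⟨n + 1, (PMF.mem_support_bind_iff _ _ _).2 ⟨_, hn, ?_⟩⟩
  rw [step, PMF.mem_support_map_iff]
  exact ⟨x, PMF.mem_support_uniformOfFintype x, dropGrain_stabilize σ x⟩

theorem stabilize_mem_recurrentStates_of_three_le [NeZero m] {σ : Sandpile m}
    (h : ∀ x, 3 ≤ σ x) : stabilize σ ∈ recurrentStates m := by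
  induction hk : ∑ x, (σ x - 3) generalizing σ with
  | zero =>
    have : σ = (maxState m).1 := funext fun x => by
      have h1 := (Finset.sum_eq_zero_iff.1 hk) x (Finset.mem_univ x)
      have h2 := h x
      simp only [maxState]
      omega
    rw [this, stabilize_stable]
    exact ⟨0, by simp [law]⟩
  | succ k ih =>
    obtain ⟨z, -, hz⟩ : ∃ z ∈ Finset.univ, σ z - 3 ≠ 0 :=
      Finset.exists_ne_zero_of_sum_ne_zero (by omega)
    obtain ⟨w, rfl⟩ : ∃ w : Sandpile m, σ = w + Pi.single z 1 := by
      refine ⟨σ - Pi.single z 1, funext fun y => ?_⟩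
      simp only [Pi.add_apply, Pi.sub_apply, Pi.single_apply]
      split_ifs with hy
      · subst hy; omega
      · omega
    have hw : ∀ x, 3 ≤ w x := fun x => by
      have h1 := h x
      simp only [Pi.add_apply, Pi.single_apply] at h1 hz
      split_ifs at h1 with hx
      · subst hx
        simp only [if_true] at hz
        omega
      · omega
    have hsum : ∑ x, (w x - 3) = k := by
      have h1 : ∀ x, (w + Pi.single z 1 : Sandpile m) x - 3
          = (w x - 3) + if x = z then 1 else 0 := fun x => by
        have := hw x
        simp only [Pi.add_apply, Pi.single_apply]
        omega
      rw [Finset.sum_congr rfl fun x _ => h1 x, Finset.sum_add_distrib] at hk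
      simpa using hk
    have := stabilize_addGrain_mem_recurrentStates (ih hw hsum) z.1
    rwa [addGrain, dif_pos z.2] at this

/-- A stable state without forbidden subconfiguration is recurrent: it is restored by firing the
sink any number of times, and enough firings put three grains on every site. -/
theorem mem_recurrentStates_of_no_forbidden [NeZero m] (hm : 2 ≤ m) {η : StableState m}
    (hη : ∀ F : Finset (Site m), F.Nonempty → ∃ x ∈ F, ∑ y ∈ F, edges y.1 x.1 ≤ η.1 x) :
    η ∈ recurrentStates m := by
  obtain ⟨k, c, hc, h3⟩ := exists_fill hm 3
  have hk : ∀ j : ℕ, Relation.ReflTransGen LegalTopple (η.1 + j • sinkFiring m) η.1 := by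
    intro j
    induction j with
    | zero => simpa using .refl
    | succ j ih =>
      have := legalPath_add_right ih (sinkFiring m)
      rw [add_assoc, ← succ_nsmul] at this
      exact this.trans (legalPath_add_sinkFiring hη)
  have hc' := legalPath_add_right hc η.1
  rw [add_comm _ η.1, add_comm _ η.1] at hc'
  rw [← stabilize_stable η, ← stabilize_eq_of_legalPath (hk k), stabilize_eq_of_legalPath hc']
  exact stabilize_mem_recurrentStates_of_three_le fun x => le_add_left (h3 x)

/-! ### Hitting probabilities on the torus -/

/-- The sum of a function over the four neighbours of `x`. -/
def neighborSum (f : Torus m → ℝ) (x : Torus m) : ℝ :=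
  f (x + (1, 0)) + f (x - (1, 0)) + f (x + (0, 1)) + f (x - (0, 1))

/-- The maximum principle for functions that are subharmonic off a set containing the sink. -/
theorem le_of_subharmonic [NeZero m] {B : Set (Torus m)} (h0 : (0 : Torus m) ∈ B)
    {f : Torus m → ℝ} {c : ℝ} (hB : ∀ y ∈ B, f y ≤ c)
    (hf : ∀ y ∉ B, 4 * f y ≤ neighborSum f y) (y : Torus m) : f y ≤ c := by
  obtain ⟨z, hz⟩ := Finite.exists_max f
  refine (hz y).trans ?_
  -- The maximum propagates from `z` towards the sink until `B` is met.
  induction hd : z.1.val + z.2.val using Nat.strong_induction_on generalizing z with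
  | _ d ih =>
    by_cases hzB : z ∈ B
    · exact hB z hzB
    · have h1 := hz (z + (1, 0))
      have h2 := hz (z - (1, 0))
      have h3 := hz (z + (0, 1))
      have h4 := hz (z - (0, 1))
      have h5 := hf z hzB
      unfold neighborSum at h5
      by_cases hz1 : z.1 = 0
      · have hz2 : z.2 ≠ 0 := fun h => hzB ((Prod.ext hz1 h : z = 0) ▸ h0)
        have e := val_sub_one z.2 hz2
        have heq : f (z - (0, 1)) = f z := by linarith
        rw [← heq]
        refine ih _ ?_ _ (fun w => heq ▸ hz w) rfl
        simp only [Prod.fst_sub, Prod.snd_sub, sub_zero]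
        omega
      · have e := val_sub_one z.1 hz1
        have heq : f (z - (1, 0)) = f z := by linarith
        rw [← heq]
        refine ih _ ?_ _ (fun w => heq ▸ hz w) rfl
        simp only [Prod.fst_sub, Prod.snd_sub, sub_zero]
        omega

open Classical in
/-- The linear map `f ↦ f` on `B`, `f ↦ 4 f - neighborSum f` off `B`. -/
noncomputable def dirichletOp (B : Set (Torus m)) : (Torus m → ℝ) →ₗ[ℝ] (Torus m → ℝ) where
  toFun f y := if y ∈ B then f y else 4 * f y - neighborSum f y
  map_add' f g := by
    funext y
    simp only [neighborSum, Pi.add_apply]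
    split_ifs <;> ring
  map_smul' c f := by
    funext y
    simp only [neighborSum, Pi.smul_apply, smul_eq_mul, RingHom.id_apply]
    split_ifs <;> ring

theorem dirichletOp_injective [NeZero m] {B : Set (Torus m)} (h0 : (0 : Torus m) ∈ B) :
    Function.Injective (dirichletOp B) := by
  have key : ∀ f, dirichletOp B f = 0 → ∀ y, f y ≤ 0 := fun f hf =>
    le_of_subharmonic h0
      (fun y hy => by simpa [dirichletOp, hy] using (congrFun hf y).le)
      (fun y hy => by
        have := congrFun hf y
        simp only [dirichletOp, LinearMap.coe_mk, AddHom.coe_mk, if_neg hy, Pi.zero_apply] at this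
        linarith)
  rw [← LinearMap.ker_eq_bot, LinearMap.ker_eq_bot']
  intro f hf
  funext y
  have h1 := key f hf y
  have h2 := key (-f) (by rw [map_neg, hf, neg_zero]) y
  simp only [Pi.neg_apply] at h2
  simp only [Pi.zero_apply]
  linarith

/-- The probability `h y` that simple random walk from `y` hits `x` before the sink. The reflection
`y ↦ x - y` of the torus exchanges `x` with the sink, so the average of `h` is one half. -/
theorem exists_hitting_probability [NeZero m] (x : Torus m) (hx : x ≠ 0) :
    ∃ h : Torus m → ℝ, h 0 = 0 ∧ (∀ y, 0 ≤ h y) ∧ (∀ y, h y ≤ 1) ∧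
      (∀ y, y ≠ 0 → y ≠ x → neighborSum h y = 4 * h y) ∧ ∑ y, h y = (m : ℝ) ^ 2 / 2 := by
  classical
  set B : Set (Torus m) := {0, x} with hBdef
  have h0B : (0 : Torus m) ∈ B := by simp [hBdef]
  have hxB : x ∈ B := by simp [hBdef]
  obtain ⟨h, hh⟩ := LinearMap.injective_iff_surjective.1 (dirichletOp_injective h0B)
    (Pi.single x 1)
  have hh0 : h 0 = 0 := by
    simpa [dirichletOp, h0B, Pi.single_apply, hx.symm] using congrFun hh 0
  have hhx : h x = 1 := by
    simpa [dirichletOp, hxB] using congrFun hh x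
  have harm : ∀ y ∉ B, neighborSum h y = 4 * h y := fun y hy => by
    have hyx : y ≠ x := fun e => hy (e ▸ hxB)
    have := congrFun hh y
    simp only [dirichletOp, LinearMap.coe_mk, AddHom.coe_mk, if_neg hy, Pi.single_apply,
      if_neg hyx] at this
    linarith
  have hB : ∀ y ∈ B, h y = 0 ∨ h y = 1 := by
    rintro y (rfl | rfl)
    · exact Or.inl hh0
    · exact Or.inr hhx
  refine ⟨h, hh0, fun y => ?_, ?_, fun y h1 h2 => harm y (by simp [hBdef, h1, h2]), ?_⟩
  · have := le_of_subharmonic h0B (f := -h) (c := 0)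
      (fun y hy => by rcases hB y hy with h | h <;> simp [h])
      (fun y hy => by
        have := harm y hy
        simp only [neighborSum, Pi.neg_apply] at this ⊢
        linarith) y
    simpa using this
  · exact le_of_subharmonic h0B (fun y hy => by rcases hB y hy with h | h <;> simp [h])
      (fun y hy => (harm y hy).ge)
  · have hsymm : (fun y => 1 - h (x - y)) = h := by
      apply dirichletOp_injective h0B
      rw [hh]
      funext y
      simp only [dirichletOp, LinearMap.coe_mk, AddHom.coe_mk]
      split_ifs with hy
      · rcases hy with rfl | rfl
        · simp [hhx, hx.symm]
        · simp [hh0]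
      · have hyx : y ≠ x := fun e => hy (e ▸ hxB)
        have hy' : x - y ∉ B := by
          rintro (e | e)
          · exact hyx (sub_eq_zero.1 e).symm
          · exact hy (Or.inl (by simpa using e))
        have := harm _ hy'
        simp only [neighborSum] at this ⊢
        rw [Pi.single_eq_of_ne hyx, ← sub_sub x y, ← sub_sub x y, sub_sub_eq_add_sub x y,
          sub_sub_eq_add_sub x y, add_sub_right_comm x, add_sub_right_comm x]
        linarith
    have h1 : ∑ y, h y = ∑ y : Torus m, (1 - h (x - y)) := by
      conv_lhs => rw [← hsymm]
    have h2 : ∑ y, h (x - y) = ∑ y, h y := (Equiv.subLeft x).sum_comp h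
    rw [Finset.sum_sub_distrib, h2] at h1
    simp only [Finset.sum_const, Finset.card_univ, Fintype.card_prod, ZMod.card, nsmul_eq_mul,
      Nat.cast_mul, mul_one] at h1
    linarith

/-- The total of the grains of `σ`, weighted by `h`. -/
def weighted [NeZero m] (h : Torus m → ℝ) (σ : Sandpile m) : ℝ := ∑ y : Site m, h y.1 * σ y

/-- If the stabilization of `σ` is transient, then some site `x` has not toppled, and so the sum
of the grains weighted by the hitting probability of `x` has been conserved. -/
theorem exists_weighted_le_of_not_recurrent [NeZero m] (hm : 2 ≤ m)
    (h : Site m → Torus m → ℝ) (h_zero : ∀ x, h x 0 = 0) (h_nonneg : ∀ x y, 0 ≤ h x y)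
    (h_harm : ∀ x y, y ≠ 0 → y ≠ x.1 → neighborSum (h x) y = 4 * h x y)
    (h_sum : ∀ x, ∑ y, h x y = (m : ℝ) ^ 2 / 2)
    {σ : Sandpile m} (hσ : stabilize σ ∉ recurrentStates m) :
    ∃ x, weighted (h x) σ ≤ 3 * (m : ℝ) ^ 2 / 2 := by
  obtain ⟨hpath, hst⟩ := stabilizesTo_stabilize σ
  obtain ⟨v, hv, hF⟩ := exists_odometer hm hpath
  obtain ⟨x, hx⟩ : ∃ x, v x = 0 := by
    by_contra! hc
    exact hσ (mem_recurrentStates_of_no_forbidden hm fun F hne => hF F hne fun x _ => hc x)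
  refine ⟨x, ?_⟩
  set η := (stabilize σ).1
  have hcast : ∀ y : Site m, h x y.1 * σ y = h x y.1 * η y + 4 * h x y.1 * v y
      - ∑ z : Site m, v z * (edges z.1 y.1 * h x y.1) := fun y => by
    have h1 : (η y : ℝ) + 4 * v y = σ y + ∑ z : Site m, (v z : ℝ) * edges z.1 y.1 := by
      exact_mod_cast hv y
    have h2 : ∑ z : Site m, (v z : ℝ) * (edges z.1 y.1 * h x y.1)
        = h x y.1 * ∑ z : Site m, (v z : ℝ) * edges z.1 y.1 := by
      rw [Finset.mul_sum]
      exact Finset.sum_congr rfl fun z _ => by ring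
    rw [h2]
    linear_combination (-h x y.1) * h1
  have hgreen : ∑ y : Site m, ∑ z : Site m, (v z : ℝ) * (edges z.1 y.1 * h x y.1)
      = ∑ y : Site m, 4 * h x y.1 * v y := by
    rw [Finset.sum_comm]
    refine Finset.sum_congr rfl fun z _ => ?_
    rw [← Finset.mul_sum, sum_site_eq (fun y => (edges z.1 y : ℝ) * h x y) (by simp [h_zero]),
      sum_edges_mul]
    by_cases hzx : z = x
    · simp [hzx, hx]
    · have := h_harm x z.1 z.2 (fun e => hzx (Subtype.ext e))
      unfold neighborSum at this
      rw [this]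
      ring
  have hsum3 : ∑ y : Site m, h x y.1 * η y ≤ ∑ y : Site m, h x y.1 * 3 :=
    Finset.sum_le_sum fun y _ => mul_le_mul_of_nonneg_left (by exact_mod_cast hst y) (h_nonneg x _)
  rw [← Finset.sum_mul, sum_site_eq (h x) (h_zero x), h_sum] at hsum3
  unfold weighted
  rw [Finset.sum_congr rfl fun y _ => hcast y, Finset.sum_sub_distrib, Finset.sum_add_distrib,
    hgreen]
  linarith

/-! ### Dropping grains without toppling -/

/-- The law of the sandpile after `n` random grains are added to `σ` without any toppling. -/
noncomputable def rawLaw [NeZero m] (σ : Sandpile m) : ℕ → PMF (Sandpile m)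
  | 0 => PMF.pure σ
  | n + 1 => (rawLaw σ n).bind fun τ => (PMF.uniformOfFintype (Torus m)).map (addGrain τ)

/-- The abelian property for the chain: topplings may be postponed to the end. -/
theorem law_eq_map_rawLaw [NeZero m] (σ : StableState m) (n : ℕ) :
    law σ n = (rawLaw σ.1 n).map stabilize := by
  induction n with
  | zero => simp [law, rawLaw, PMF.pure_map, stabilize_stable]
  | succ n ih =>
    rw [law, rawLaw, ih, PMF.bind_map, PMF.map_bind]
    congr 1
    funext τ
    rw [Function.comp_apply, step, PMF.map_comp]
    congr 1
    funext x
    exact dropGrain_stabilize τ x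

theorem weighted_addGrain [NeZero m] {h : Torus m → ℝ} (h0 : h 0 = 0) (σ : Sandpile m)
    (x : Torus m) : weighted h (addGrain σ x) = weighted h σ + h x := by
  unfold weighted addGrain
  split_ifs with hx
  · simp [mul_add, Finset.sum_add_distrib, Pi.single_apply]
  · simp [not_not.1 hx, h0]

theorem tsum_bind_mul {α β : Type*} (p : PMF α) (q : α → PMF β) (f : β → ENNReal) :
    ∑' b, (p.bind q) b * f b = ∑' a, p a * ∑' b, q a b * f b := by
  simp only [PMF.bind_apply, ← ENNReal.tsum_mul_right, ← ENNReal.tsum_mul_left]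
  rw [ENNReal.tsum_comm]
  simp only [mul_assoc]

theorem tsum_map_mul {α β : Type*} (p : PMF α) (g : α → β) (f : β → ENNReal) :
    ∑' b, (p.map g) b * f b = ∑' a, p a * f (g a) := by
  rw [PMF.map, tsum_bind_mul]
  refine tsum_congr fun a => ?_
  rw [tsum_eq_single (g a)]
  · simp
  · intro b hb
    simp [hb]

/-- The exponential moment of one grain, if the weights are in `[0, 1]` and average one half. -/
theorem sum_exp_neg_le [NeZero m] {h : Torus m → ℝ} (h_nonneg : ∀ y, 0 ≤ h y)
    (h_le : ∀ y, h y ≤ 1) (h_sum : ∑ y, h y = (m : ℝ) ^ 2 / 2) :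
    ∑ y, Real.exp (-h y) ≤ (m : ℝ) ^ 2 * Real.exp (-(1 / 4)) := by
  have hpt : ∀ y, Real.exp (-h y) ≤ 1 - h y / 2 := fun y => by
    rw [Real.exp_neg]
    refine inv_le_of_inv_le₀ (by linarith [h_le y]) ?_
    refine le_trans ?_ (Real.add_one_le_exp (h y))
    rw [inv_le_iff_one_le_mul₀ (by linarith [h_le y])]
    nlinarith [h_nonneg y, h_le y]
  calc ∑ y, Real.exp (-h y) ≤ ∑ y, (1 - h y / 2) := Finset.sum_le_sum fun y _ => hpt y
    _ = (m : ℝ) ^ 2 * (3 / 4) := by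
      rw [Finset.sum_sub_distrib, ← Finset.sum_div, h_sum]
      simp only [Finset.sum_const, Finset.card_univ, Fintype.card_prod, ZMod.card, nsmul_eq_mul,
        Nat.cast_mul, mul_one]
      ring
    _ ≤ _ := by
      gcongr
      linarith [Real.add_one_le_exp (-(1 / 4 : ℝ))]

theorem tsum_rawLaw_exp_le [NeZero m] {h : Torus m → ℝ} (h_zero : h 0 = 0)
    (h_nonneg : ∀ y, 0 ≤ h y) (h_le : ∀ y, h y ≤ 1) (h_sum : ∑ y, h y = (m : ℝ) ^ 2 / 2)
    (σ : Sandpile m) (n : ℕ) :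
    ∑' τ, rawLaw σ n τ * ENNReal.ofReal (Real.exp (-weighted h τ))
      ≤ ENNReal.ofReal (Real.exp (-(n / 4))) := by
  induction n with
  | zero =>
    rw [tsum_eq_single σ]
    · have : 0 ≤ weighted h σ :=
        Finset.sum_nonneg fun y _ => mul_nonneg (h_nonneg _) (Nat.cast_nonneg _)
      simpa [rawLaw] using this
    · intro τ hτ
      simp [rawLaw, hτ]
  | succ n ih =>
    have hm : (0 : ℝ) < (m : ℝ) ^ 2 := by
      have := NeZero.pos m
      positivity
    have hstep : ∀ τ : Sandpile m,
        ∑' τ', ((PMF.uniformOfFintype (Torus m)).map (addGrain τ)) τ'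
            * ENNReal.ofReal (Real.exp (-weighted h τ'))
          ≤ ENNReal.ofReal (Real.exp (-weighted h τ)) * ENNReal.ofReal (Real.exp (-(1 / 4))) := by
      intro τ
      rw [tsum_map_mul, tsum_fintype]
      have hcard : ((Fintype.card (Torus m) : ENNReal))⁻¹ = ENNReal.ofReal (((m : ℝ) ^ 2)⁻¹) := by
        rw [ENNReal.ofReal_inv_of_pos hm, ← Nat.cast_pow, ENNReal.ofReal_natCast]
        simp [Fintype.card_prod, ZMod.card, sq]
      simp only [PMF.uniformOfFintype_apply, hcard, weighted_addGrain h_zero]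
      rw [← Finset.mul_sum, ← ENNReal.ofReal_sum_of_nonneg fun _ _ => (Real.exp_pos _).le,
        ← ENNReal.ofReal_mul (by positivity), ← ENNReal.ofReal_mul (Real.exp_pos _).le]
      apply ENNReal.ofReal_le_ofReal
      simp only [neg_add, Real.exp_add]
      rw [← Finset.mul_sum, mul_left_comm]
      gcongr
      rw [inv_mul_le_iff₀ hm]
      exact sum_exp_neg_le h_nonneg h_le h_sum
    calc ∑' τ, rawLaw σ (n + 1) τ * ENNReal.ofReal (Real.exp (-weighted h τ))
        ≤ ∑' τ, rawLaw σ n τ * (ENNReal.ofReal (Real.exp (-weighted h τ))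
            * ENNReal.ofReal (Real.exp (-(1 / 4)))) := by
          rw [rawLaw, tsum_bind_mul]
          exact ENNReal.tsum_le_tsum fun τ => mul_le_mul_right (hstep τ) _
      _ ≤ ENNReal.ofReal (Real.exp (-(n / 4))) * ENNReal.ofReal (Real.exp (-(1 / 4))) := by
          simp only [← mul_assoc]
          rw [ENNReal.tsum_mul_right]
          exact mul_le_mul_left ih _
      _ = ENNReal.ofReal (Real.exp (-((n + 1 : ℕ) / 4))) := by
          rw [← ENNReal.ofReal_mul (Real.exp_pos _).le, ← Real.exp_add]
          congr 2
          push_cast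
          ring

/-- The exponential Markov inequality for each site, and a union bound over the sites. -/
theorem one_sub_le_law_recurrentStates [NeZero m] (hm : 2 ≤ m) (σ : StableState m) (n : ℕ) :
    1 - (m : ℝ) ^ 2 * Real.exp (3 * (m : ℝ) ^ 2 / 2 - n / 4)
      ≤ ((law σ n).toOuterMeasure (recurrentStates m)).toReal := by
  classical
  choose h h_zero h_nonneg h_le h_harm h_sum using
    fun x : Site m => exists_hitting_probability x.1 x.2
  set p := rawLaw σ.1 n
  set A : Set (Sandpile m) := stabilize ⁻¹' recurrentStates m
  set T : ℝ := 3 * (m : ℝ) ^ 2 / 2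
  rw [law_eq_map_rawLaw, PMF.toOuterMeasure_map_apply]
  have hpt : ∀ τ, p τ ≤ A.indicator p τ
      + ∑ x, p τ * (ENNReal.ofReal (Real.exp (-weighted (h x) τ)) * ENNReal.ofReal (Real.exp T)) := by
    intro τ
    by_cases hτ : τ ∈ A
    · rw [Set.indicator_of_mem hτ]
      exact le_self_add
    · obtain ⟨x, hx⟩ := exists_weighted_le_of_not_recurrent hm h h_zero h_nonneg h_harm h_sum hτ
      refine le_trans ?_ (le_add_left (Finset.single_le_sum (fun _ _ => zero_le)
        (Finset.mem_univ x)))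
      rw [← ENNReal.ofReal_mul (Real.exp_pos _).le, ← Real.exp_add]
      refine le_mul_of_one_le_right' ?_
      rw [ENNReal.one_le_ofReal, Real.one_le_exp_iff]
      have : weighted (h x) τ ≤ T := hx
      linarith
  have hsum : (1 : ENNReal) ≤ p.toOuterMeasure A
      + ∑ _x : Site m, ENNReal.ofReal (Real.exp (-(n / 4))) * ENNReal.ofReal (Real.exp T) := by
    calc (1 : ENNReal) = ∑' τ, p τ := p.tsum_coe.symm
      _ ≤ _ := ENNReal.tsum_le_tsum hpt
      _ = p.toOuterMeasure A + ∑ x, (∑' τ, p τ * ENNReal.ofReal (Real.exp (-weighted (h x) τ)))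
            * ENNReal.ofReal (Real.exp T) := by
          rw [ENNReal.tsum_add, PMF.toOuterMeasure_apply, Summable.tsum_finsetSum
            fun _ _ => ENNReal.summable]
          simp only [← mul_assoc, ENNReal.tsum_mul_right]
      _ ≤ _ := by
          gcongr with x
          exact tsum_rawLaw_exp_le (h_zero x) (h_nonneg x) (h_le x) (h_sum x) σ.1 n
  have hfin : p.toOuterMeasure A ≠ ⊤ :=
    ne_top_of_le_ne_top p.tsum_coe_ne_top ((p.toOuterMeasure_apply A).trans_le
      (ENNReal.tsum_le_tsum fun τ => Set.indicator_le_self _ _ τ))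
  rw [Finset.sum_const, ← ENNReal.ofReal_mul (Real.exp_pos _).le, ← Real.exp_add, nsmul_eq_mul,
    ← ENNReal.ofReal_natCast, ← ENNReal.ofReal_mul (Nat.cast_nonneg _),
    ← ENNReal.ofReal_toReal hfin, ← ENNReal.ofReal_add ENNReal.toReal_nonneg (by positivity),
    ENNReal.one_le_ofReal] at hsum
  have hcard : ((Finset.univ : Finset (Site m)).card : ℝ) ≤ (m : ℝ) ^ 2 := by
    rw [Finset.card_univ]
    have := Fintype.card_subtype_le fun x : Torus m => x ≠ 0
    rw [Fintype.card_prod, ZMod.card, ← sq] at this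
    exact_mod_cast this
  have hexp : -((n : ℝ) / 4) + T = T - n / 4 := by ring
  rw [hexp] at hsum
  have := mul_le_mul_of_nonneg_right hcard (Real.exp_pos (T - n / 4)).le
  linarith

end TorusSandpile

/-- The error `δ m` is uniform in the initial state `σ` and in the number `n` of steps. -/
theorem proposition4p1 :
    ∃ C : ℝ, 0 < C ∧ ∃ δ : ℕ → ℝ, Tendsto δ atTop (𝓝 0) ∧
      ∀ (m : ℕ) [NeZero m] (σ : TorusSandpile.StableState m) (n : ℕ),
        C * (m : ℝ) ^ 2 * Real.sqrt (Real.log m) < (n : ℝ) →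
          1 - δ m ≤
            ((TorusSandpile.law σ n).toOuterMeasure (TorusSandpile.recurrentStates m)).toReal := by
  -- For `m ≥ 3` the square root is at least one, and then `8 * m ^ 2` steps suffice.
  refine ⟨8, by norm_num, fun m => if m < 3 then 1 else (m : ℝ) ^ 2 * Real.exp (-m), ?_, ?_⟩
  · have h := (Real.tendsto_pow_mul_exp_neg_atTop_nhds_zero 2).comp tendsto_natCast_atTop_atTop
    refine h.congr' ?_
    filter_upwards [eventually_ge_atTop 3] with m hm
    rw [if_neg (by omega)]
    rfl
  · intro m _ σ n hn
    by_cases hm : m < 3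
    · simp only [if_pos hm, sub_self]
      exact ENNReal.toReal_nonneg
    · simp only [if_neg hm]
      have hm3 : (3 : ℝ) ≤ m := by exact_mod_cast not_lt.1 hm
      refine le_trans ?_ (TorusSandpile.one_sub_le_law_recurrentStates (by omega) σ n)
      have hsqrt : 1 ≤ Real.sqrt (Real.log m) := by
        rw [Real.one_le_sqrt, Real.le_log_iff_exp_le (by linarith)]
        linarith [Real.exp_one_lt_d9]
      have hn8 : 8 * (m : ℝ) ^ 2 < n :=
        lt_of_le_of_lt (le_mul_of_one_le_right (by positivity) hsqrt) hn
      gcongr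
      nlinarith
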